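/- Let $\mathbb N=\{1,2,\dots\}$ and $[k]=\{1,\dots,k\}$. Posets are non-empty and are described by their strict order; $Q^\circ$ denotes the ground set of $Q$ and $<_Q$ its order. For posets $P,Q$ write $P\supset Q$ if $Q^\circ\subseteq P^\circ$ and $x<_Q y\Rightarrow x<_P y$ for all $x,y\in Q^\circ$, and let $P|_A$ be the restriction of $P$ to $A\subseteq P^\circ$. The space $\mathcal P_{\mathbb N}$ of all labelled posets on $\mathbb N$ is regarded, through the indicators $\mathbf 1[i<_P j]$, as a subset of $\{0,1\}^{\mathbb N\times\mathbb N}$ with the product topology and its Borel $\sigma$-field. A random infinite poset is a random element of $\mathcal P_{\mathbb N}$; it (or its distribution) is exchangeable if its distribution is invariant under every permutation of $\mathbb N$. **Theorem 1.6.** Let $R$ be an exchangeable random infinite poset. Then the following are equivalent. (i) The distribution of $R$ is an extreme point of the set of exchangeable probability distributions on $\mathcal P_{\mathbb N}$. (ii) If $Q_1$ and $Q_2$ are two finite posets with disjoint ground sets contained in $\mathbb N$, then $$\mathbb P(R\supset Q_1\cup Q_2)=\mathbb P(R\supset Q_1)\,\mathbb P(R\supset Q_2),$$ where $Q_1\cup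 Q_2$ is the poset with ground set $Q_1^\circ\cup Q_2^\circ$ in which $x<y$ if and only if $x<_{Q_1}y$ or $x<_{Q_2}y$. (iii) The restrictions $R|_{[k]}$ and $R|_{[k+1,\infty)}$ are independent for every $k\in\mathbb N$. (iv) Let $\mathcal F_n$ be the $\sigma$-field generated by $R|_{[n,\infty)}$. The tail $\sigma$-field $\bigcap_{n=1}^\infty\mathcal F_n$ is trivial, i.e. contains only events of probability $0$ or $1$. -/

import Mathlib

open MeasureTheory ProbabilityTheory
open scoped NNReal

/-- A labelled poset with ground set `V`, given by its strict order relation `<`. -/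
@[ext]
structure LabelledPoset (V : Type*) where
  lt : V → V → Prop
  irrefl : ∀ x, ¬ lt x x
  trans : ∀ x y z, lt x y → lt y z → lt x z

namespace LabelledPoset

variable {V : Type*}

/-- The space of posets on `V` is seen as a subset of the product space `{0,1}^(V × V)` through the
indicators of `i < j`, and carries the trace of the product σ-field. For countable `V` this is the
Borel σ-field of the (compact metrizable) product topology. -/
instance instMeasurableSpace : MeasurableSpace (LabelledPoset V) :=
  MeasurableSpace.comap (fun P : LabelledPoset V => P.lt) inferInstance

theorem measurable_lt : Measurable (fun P : LabelledPoset V => P.lt) :=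
  comap_measurable _

/-- The poset with the indicator array `I (σ i) (σ j)`, where `I i j` is that of `P`. -/
def relabel (σ : Equiv.Perm V) (P : LabelledPoset V) : LabelledPoset V where
  lt i j := P.lt (σ i) (σ j)
  irrefl i := P.irrefl (σ i)
  trans i j k := P.trans (σ i) (σ j) (σ k)

/-- The restriction `P|_A` of a poset to a subset `A` of its ground set. -/
def restrict (P : LabelledPoset V) (A : Set V) : LabelledPoset A where
  lt i j := P.lt i j
  irrefl i := P.irrefl i
  trans i j k := P.trans i j k

/-- `P.Contains Q` says `P ⊃ Q`: the poset `Q`, whose ground set `A` is a subset of that of `P`, is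
a (not necessarily induced) subposet of `P`. -/
def Contains (P : LabelledPoset V) {A : Set V} (Q : LabelledPoset A) : Prop :=
  ∀ x y : A, Q.lt x y → P.lt x y

/-- The union `Q₁ ∪ Q₂` of two posets with disjoint ground sets: `x < y` if and only if `x < y` in
`Q₁` or `x < y` in `Q₂`. -/
def union {A₁ A₂ : Set V} (h : Disjoint A₁ A₂) (Q₁ : LabelledPoset A₁) (Q₂ : LabelledPoset A₂) :
    LabelledPoset (A₁ ∪ A₂ : Set V) where
  lt x y :=
    (∃ (hx : (x : V) ∈ A₁) (hy : (y : V) ∈ A₁), Q₁.lt ⟨x, hx⟩ ⟨y, hy⟩) ∨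
    (∃ (hx : (x : V) ∈ A₂) (hy : (y : V) ∈ A₂), Q₂.lt ⟨x, hx⟩ ⟨y, hy⟩)
  irrefl x := by
    rintro (⟨hx, _, hlt⟩ | ⟨hx, _, hlt⟩)
    · exact Q₁.irrefl _ hlt
    · exact Q₂.irrefl _ hlt
  trans x y z := by
    rintro (⟨hx, hy, h₁⟩ | ⟨hx, hy, h₁⟩) (⟨hy', hz, h₂⟩ | ⟨hy', hz, h₂⟩)
    · exact Or.inl ⟨hx, hz, Q₁.trans _ _ _ h₁ h₂⟩
    · exact (Set.disjoint_left.mp h hy hy').elim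
    · exact (Set.disjoint_left.mp h hy' hy).elim
    · exact Or.inr ⟨hx, hz, Q₂.trans _ _ _ h₁ h₂⟩

theorem measurable_relabel (σ : Equiv.Perm V) :
    Measurable (relabel σ : LabelledPoset V → LabelledPoset V) := by
  refine measurable_comap_iff.mpr (measurable_pi_lambda _ fun i => measurable_pi_lambda _ fun j => ?_)
  exact (measurable_pi_apply (σ j)).comp ((measurable_pi_apply (σ i)).comp measurable_lt)

theorem measurable_restrict (A : Set V) :
    Measurable (fun P : LabelledPoset V => P.restrict A) := by
  refine measurable_comap_iff.mpr (measurable_pi_lambda _ fun i => measurable_pi_lambda _ fun j => ?_)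
  exact (measurable_pi_apply (j : V)).comp ((measurable_pi_apply (i : V)).comp measurable_lt)

end LabelledPoset

/-- The set of exchangeable distributions on the space of all labelled posets on `{1, 2, …}`: the
probability measures that are invariant under every permutation of the labels. -/
def exchangeableLaws : Set (Measure (LabelledPoset ℕ+)) :=
  {ν | IsProbabilityMeasure ν ∧ ∀ σ : Equiv.Perm ℕ+, ν.map (LabelledPoset.relabel σ) = ν}

/-- The σ-field on `Ω` generated by the restriction of the random poset `R` to `[n, ∞)`. -/
@[reducible]
def sigmaFrom {Ω : Type*} (R : Ω → LabelledPoset ℕ+) (n : ℕ+) : MeasurableSpace Ω :=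
  MeasurableSpace.comap (fun ω => (R ω).restrict (Set.Ici n)) inferInstance

/-- The tail σ-field of the random poset `R`. -/
@[reducible]
def tailSigma {Ω : Type*} (R : Ω → LabelledPoset ℕ+) : MeasurableSpace Ω :=
  ⨅ n : ℕ+, sigmaFrom R n

/-!
(ii) ⇔ (iii): the events that a finite set `S` of relations holds form a π-system that generates the
σ-field, and by transitive closure each non-empty one says that the random poset contains a poset on
the labels occurring in `S`. Hence (ii) implies (iii). Conversely, exchangeability allows one to
move the labels of `Q₂` beyond all those of `Q₁`.

(i) ⇒ (iii): let `f` be an injection of the labels that avoids `A`. Relabelling along `f` turns the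
law of `R`, conditioned on any event that depends on `R|_A` only, into an exchangeable law, and the
unconditioned law into itself. Conditioning on an event and on its complement therefore writes the
law as a mixture, which extremality forces to be trivial. (iii) ⇒ (iv) is Kolmogorov's zero-one law.
(iv) ⇒ (i): a shift-invariant event is a tail event, so the law is ergodic for the shift, hence
extreme already among all shift-invariant laws.
-/

theorem indepFun_comp_of_map {Ω X Y Z : Type*} [MeasurableSpace Ω] [MeasurableSpace X]
    [MeasurableSpace Y] [MeasurableSpace Z] {μ : Measure Ω} {R : Ω → X} {f : X → Y} {g : X → Z}
    (hR : Measurable R) (hf : Measurable f) (hg : Measurable g) (h : IndepFun f g (μ.map R)) :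
    IndepFun (fun ω => f (R ω)) (fun ω => g (R ω)) μ := by
  rw [indepFun_iff_measure_inter_preimage_eq_mul] at h ⊢
  intro s t hs ht
  have hst := h s t hs ht
  rwa [Measure.map_apply hR ((hf hs).inter (hg ht)), Measure.map_apply hR (hf hs),
    Measure.map_apply hR (hg ht)] at hst

theorem measure_eq_zero_or_one_of_le_iSup_of_indep {Ω ι : Type*} [mΩ : MeasurableSpace Ω]
    {μ : Measure Ω} [IsProbabilityMeasure μ] [SemilatticeSup ι]
    {m : ι → MeasurableSpace Ω} {t : MeasurableSpace Ω} (hm : Monotone m) (hle : ∀ i, m i ≤ mΩ)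
    (ht : t ≤ ⨆ i, m i) (h : ∀ i, Indep (m i) t μ) {E : Set Ω} (hE : MeasurableSet[t] E) :
    μ E = 0 ∨ μ E = 1 := by
  have hind : Indep (⨆ i, m i) t μ := indep_iSup_of_monotone h hle (ht.trans (iSup_le hle)) hm
  exact measure_eq_zero_or_one_of_indepSet_self (hind.indepSet_of_measurableSet (ht _ hE) hE)

section ExtremePoints

variable {X Y Z : Type*} [MeasurableSpace X] [MeasurableSpace Y] [MeasurableSpace Z]
  {μ : Measure X}

theorem measurePreserving_cond {T : X → X} (hT : MeasurePreserving T μ μ) {D : Set X}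
    (hD : MeasurableSet D) (hTD : T ⁻¹' D = D) : MeasurePreserving T μ[|D] μ[|D] := by
  have hrestrict := hT.restrict_preimage hD
  rw [hTD] at hrestrict
  exact hrestrict.smul_measure _

theorem toNNReal_smul_cond_add_toNNReal_smul_cond_compl [IsFiniteMeasure μ] {D : Set X}
    (hD : MeasurableSet D) :
    (μ D).toNNReal • μ[|D] + (μ Dᶜ).toNNReal • μ[|Dᶜ] = μ := by
  ext s
  simp only [Measure.add_apply, Measure.smul_apply, ENNReal.smul_def, smul_eq_mul,
    ENNReal.coe_toNNReal (measure_ne_top μ _)]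
  rw [mul_comm, mul_comm (μ Dᶜ), cond_add_cond_compl_eq hD]

theorem map_cond_eq_of_map_mem_extremePoints [IsProbabilityMeasure μ] {g : X → Y}
    (hg : Measurable g) {K : Set (Measure Y)} (hK : μ.map g ∈ K.extremePoints ℝ≥0) {D : Set X}
    (hD : MeasurableSet D) (h0 : μ D ≠ 0) (h1 : μ Dᶜ ≠ 0) (hDK : (μ[|D]).map g ∈ K)
    (hDK' : (μ[|Dᶜ]).map g ∈ K) : (μ[|D]).map g = μ.map g := by
  refine hK.2 hDK hDK' ⟨(μ D).toNNReal, (μ Dᶜ).toNNReal,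
    ENNReal.toNNReal_pos h0 (measure_ne_top _ _), ENNReal.toNNReal_pos h1 (measure_ne_top _ _),
    ?_, ?_⟩
  · rw [← ENNReal.toNNReal_add (measure_ne_top _ _) (measure_ne_top _ _),
      measure_add_measure_compl hD, measure_univ, ENNReal.toNNReal_one]
  · conv_rhs => rw [← toNNReal_smul_cond_add_toNNReal_smul_cond_compl (μ := μ) hD]
    rw [Measure.map_add _ _ hg, Measure.map_smul, Measure.map_smul]

theorem indepFun_of_map_mem_extremePoints [IsProbabilityMeasure μ] {f : X → Z} {g : X → Y}
    (hf : Measurable f) (hg : Measurable g) {K : Set (Measure Y)}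
    (hK : μ.map g ∈ K.extremePoints ℝ≥0)
    (hcond : ∀ C, MeasurableSet C → μ (f ⁻¹' C) ≠ 0 → (μ[|f ⁻¹' C]).map g ∈ K) :
    IndepFun f g μ := by
  rw [indepFun_iff_measure_inter_preimage_eq_mul]
  intro C B hC hB
  by_cases h0 : μ (f ⁻¹' C) = 0
  · rw [h0, zero_mul, measure_inter_null_of_null_left _ h0]
  by_cases h1 : μ (f ⁻¹' C)ᶜ = 0
  · rw [(prob_compl_eq_zero_iff (hf hC)).mp h1, one_mul, Set.inter_comm, measure_inter_conull h1]
  have hmap := map_cond_eq_of_map_mem_extremePoints hg hK (hf hC) h0 h1 (hcond C hC h0)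
    (hcond Cᶜ hC.compl h1)
  have hcondB : μ[g ⁻¹' B | f ⁻¹' C] = μ (g ⁻¹' B) := by
    rw [← Measure.map_apply hg hB, hmap, Measure.map_apply hg hB]
  rw [← cond_mul_eq_inter (hf hC), hcondB, mul_comm]

theorem extremePoints_ennreal_subset_extremePoints_nnreal (K : Set (Measure X)) :
    K.extremePoints ENNReal ⊆ K.extremePoints ℝ≥0 := by
  rintro ν ⟨hν, hext⟩
  refine ⟨hν, fun ν₁ hν₁ ν₂ hν₂ ⟨a, b, ha, hb, hab, hsum⟩ => hext hν₁ hν₂ ⟨a, b, ?_, ?_, ?_, hsum⟩⟩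
  all_goals exact_mod_cast ‹_›

theorem mem_extremePoints_of_ergodic [IsProbabilityMeasure μ] {T : X → X} (hT : Ergodic T μ)
    {K : Set (Measure X)} (hK : ∀ ν ∈ K, MeasurePreserving T ν ν ∧ IsProbabilityMeasure ν)
    (hμ : μ ∈ K) : μ ∈ K.extremePoints ℝ≥0 :=
  extremePoints_ennreal_subset_extremePoints_nnreal K
    (inter_extremePoints_subset_extremePoints_of_subset hK ⟨hμ, hT.mem_extremePoints⟩)

end ExtremePoints

section Permutations

variable {V : Type*}

theorem exists_perm_eqOn {A : Set V} (hA : A.Finite) {f : V → V} (hf : A.InjOn f) :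
    ∃ σ : Equiv.Perm V, A.EqOn σ f := by
  have : Finite A := hA
  obtain ⟨σ, hσ⟩ := Equiv.Perm.exists_smul_eq_embedding
    (Function.Embedding.subtype (· ∈ A)) ⟨fun x : A => f x, hf.injective⟩
  exact ⟨σ, fun x hx => DFunLike.congr_fun hσ ⟨x, hx⟩⟩

theorem exists_perm_eqOn_id_mapsTo {A₁ A₂ B : Set V} (hA₁ : A₁.Finite) (hA₂ : A₂.Finite)
    (hA : Disjoint A₁ A₂) (hB : B.Infinite) :
    ∃ σ : Equiv.Perm V, A₁.EqOn σ id ∧ A₂.MapsTo σ B := by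
  classical
  have : Nonempty V := hB.nonempty.nonempty
  obtain ⟨g, hgB, hg⟩ : ∃ g : V → V, A₂ ⊆ g ⁻¹' (B \ A₁) ∧ A₂.InjOn g :=
    hA₂.exists_injOn_of_encard_le ((hB.sdiff hA₁).encard_eq ▸ le_top)
  have hf₁ : A₁.EqOn (A₁.piecewise id g) id := Set.piecewise_eqOn _ _ _
  have hf₂ : A₂.EqOn (A₁.piecewise id g) g :=
    (Set.piecewise_eqOn_compl _ _ _).mono hA.subset_compl_left
  have hinj : (A₁ ∪ A₂).InjOn (A₁.piecewise id g) := by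
    refine (Set.injOn_union hA).mpr
      ⟨hf₁.injOn_iff.mpr Function.injective_id.injOn, hf₂.injOn_iff.mpr hg, fun x hx y hy hxy => ?_⟩
    rw [hf₁ hx, hf₂ hy] at hxy
    exact (hgB hy).2 (hxy ▸ hx)
  obtain ⟨σ, hσ⟩ := exists_perm_eqOn (hA₁.union hA₂) hinj
  refine ⟨σ, (hσ.mono Set.subset_union_left).trans hf₁, fun x hx => ?_⟩
  rw [hσ (.inr hx), hf₂ hx]
  exact (hgB hx).1

end Permutations

namespace LabelledPoset

variable {V W : Type*}

/-- The poset on `W` whose order is that of `P` pulled back along `f : W → V`. For injective `f`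
this is `P` restricted to the range of `f` and relabelled by `W`; both `relabel` and `restrict` are
definitionally instances. -/
def comap (f : W → V) (P : LabelledPoset V) : LabelledPoset W where
  lt i j := P.lt (f i) (f j)
  irrefl i := P.irrefl (f i)
  trans i j k := P.trans (f i) (f j) (f k)

theorem measurable_lt_apply (i j : V) : Measurable fun P : LabelledPoset V => P.lt i j :=
  (measurable_pi_apply j).comp ((measurable_pi_apply i).comp measurable_lt)

theorem measurable_of_measurable_lt {X : Type*} [MeasurableSpace X] {g : X → LabelledPoset V}
    (h : ∀ i j, Measurable fun x => (g x).lt i j) : Measurable g :=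
  measurable_comap_iff.mpr (measurable_pi_lambda _ fun i => measurable_pi_lambda _ fun j => h i j)

theorem measurable_comap (f : W → V) : Measurable (comap f) :=
  measurable_of_measurable_lt fun i j => measurable_lt_apply (f i) (f j)

section RelCylinder

/-- The event that all the relations listed in `S` hold. -/
def relCylinder (S : Set (V × V)) : Set (LabelledPoset V) :=
  {P | ∀ p ∈ S, P.lt p.1 p.2}

/-- The labels that occur in the relations listed in `S`. -/
def labels (S : Set (V × V)) : Set V :=
  Prod.fst '' S ∪ Prod.snd '' S

/-- The relations of a poset on a subset `A` of `V`, as pairs of elements of `V`. -/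
def relations {A : Set V} (Q : LabelledPoset A) : Set (V × V) :=
  Prod.map (↑) (↑) '' {p : A × A | Q.lt p.1 p.2}

/-- The events that finitely many prescribed relations hold: a π-system that generates the
σ-field. -/
def relCylinders (V : Type*) : Set (Set (LabelledPoset V)) :=
  relCylinder '' {S : Set (V × V) | S.Finite}

theorem labels_finite {S : Set (V × V)} (hS : S.Finite) : (labels S).Finite :=
  (hS.image _).union (hS.image _)

theorem labels_nonempty {S : Set (V × V)} (hS : S.Nonempty) : (labels S).Nonempty :=
  (hS.image _).inl

theorem labels_subset_iff {S : Set (V × V)} {A : Set V} : labels S ⊆ A ↔ S ⊆ A ×ˢ A := by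
  simp only [labels, Set.union_subset_iff, Set.image_subset_iff, Set.prod_eq, Set.subset_inter_iff]

theorem labels_image (f : W → V) (S : Set (W × W)) :
    labels (Prod.map f f '' S) = f '' labels S := by
  simp only [labels, Set.image_union, Set.image_image, Prod.map_fst, Prod.map_snd]

theorem labels_relations_subset {A : Set V} (Q : LabelledPoset A) : labels (relations Q) ⊆ A := by
  rw [relations, labels_image]
  exact Subtype.coe_image_subset A _

theorem relations_finite {A : Set V} (hA : A.Finite) (Q : LabelledPoset A) : (relations Q).Finite :=
  (hA.prod hA).subset (labels_subset_iff.mp (labels_relations_subset Q))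

theorem relCylinder_empty : relCylinder (∅ : Set (V × V)) = Set.univ :=
  Set.eq_univ_of_forall fun _ _ hp => hp.elim

theorem relCylinder_union (S T : Set (V × V)) :
    relCylinder (S ∪ T) = relCylinder S ∩ relCylinder T :=
  Set.ext fun _ => by
    simp only [relCylinder, Set.mem_union, or_imp, forall_and, Set.mem_inter_iff, Set.mem_ofPred_eq]

theorem preimage_comap_relCylinder (f : W → V) (S : Set (W × W)) :
    comap f ⁻¹' relCylinder S = relCylinder (Prod.map f f '' S) :=
  Set.ext fun P => (Set.forall_mem_image (f := Prod.map f f) (s := S)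
    (p := fun q : V × V => P.lt q.1 q.2)).symm

theorem relCylinder_eq_preimage_restrict {A : Set V} {S : Set (V × V)} (hS : labels S ⊆ A) :
    relCylinder S = (restrict · A) ⁻¹' relCylinder (Prod.map (↑) (↑) ⁻¹' S) := by
  have himage : Prod.map (↑) (↑) '' (Prod.map ((↑) : A → V) ((↑) : A → V) ⁻¹' S) = S := by
    rw [Set.image_preimage_eq_inter_range, Set.range_prodMap, Subtype.range_coe,
      Set.inter_eq_left]
    exact labels_subset_iff.mp hS
  conv_lhs => rw [← himage, ← preimage_comap_relCylinder]
  rfl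

theorem measurableSet_relCylinder {S : Set (V × V)} (hS : S.Finite) :
    MeasurableSet (relCylinder S) := by
  have hinter : relCylinder S = ⋂ p ∈ S, {P : LabelledPoset V | P.lt p.1 p.2} := by
    ext P
    simp only [relCylinder, Set.mem_ofPred_eq, Set.mem_iInter]
  rw [hinter]
  exact hS.measurableSet_biInter fun p _ => measurableSet_setOfPred.mpr (measurable_lt_apply _ _)

theorem isPiSystem_relCylinders : IsPiSystem (relCylinders V) := by
  rintro _ ⟨S, hS, rfl⟩ _ ⟨T, hT, rfl⟩ _
  exact ⟨S ∪ T, Set.Finite.union hS hT, relCylinder_union S T⟩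

theorem generateFrom_relCylinders :
    MeasurableSpace.generateFrom (relCylinders V) = instMeasurableSpace := by
  apply le_antisymm
  · refine MeasurableSpace.generateFrom_le ?_
    rintro _ ⟨S, hS, rfl⟩
    exact measurableSet_relCylinder hS
  · have hid : @Measurable _ _ (.generateFrom (relCylinders V)) instMeasurableSpace id := by
      let _ := MeasurableSpace.generateFrom (relCylinders V)
      refine measurable_of_measurable_lt fun i j => measurableSet_setOfPred.mp ?_
      refine MeasurableSpace.measurableSet_generateFrom ⟨{(i, j)}, Set.finite_singleton _, ?_⟩
      exact Set.ext fun P => forall_eq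
    exact fun s hs => hid hs

theorem measure_ext_of_relCylinder {ν₁ ν₂ : Measure (LabelledPoset V)} [IsFiniteMeasure ν₁]
    (h : ∀ S : Set (V × V), S.Finite → ν₁ (relCylinder S) = ν₂ (relCylinder S)) : ν₁ = ν₂ := by
  refine ext_of_generate_finite _ generateFrom_relCylinders.symm isPiSystem_relCylinders ?_ ?_
  · rintro _ ⟨S, hS, rfl⟩
    exact h S hS
  · rw [← relCylinder_empty]
    exact h ∅ Set.finite_empty

theorem setOf_contains_eq_relCylinder {A : Set V} (Q : LabelledPoset A) :
    {P : LabelledPoset V | P.Contains Q} = relCylinder (relations Q) := by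
  rw [relations, ← preimage_comap_relCylinder]
  exact Set.ext fun P => ⟨fun h p hp => h p.1 p.2 hp, fun h x y hxy => h (x, y) hxy⟩

theorem contains_union_iff {A₁ A₂ : Set V} (h : Disjoint A₁ A₂) (Q₁ : LabelledPoset A₁)
    (Q₂ : LabelledPoset A₂) (P : LabelledPoset V) :
    P.Contains (union h Q₁ Q₂) ↔ P.Contains Q₁ ∧ P.Contains Q₂ := by
  constructor
  · intro hP
    exact ⟨fun x y hxy => hP ⟨x, .inl x.2⟩ ⟨y, .inl y.2⟩ (.inl ⟨x.2, y.2, hxy⟩),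
      fun x y hxy => hP ⟨x, .inr x.2⟩ ⟨y, .inr y.2⟩ (.inr ⟨x.2, y.2, hxy⟩)⟩
  · rintro ⟨h₁, h₂⟩ x y (⟨hx, hy, hxy⟩ | ⟨hx, hy, hxy⟩)
    · exact h₁ _ _ hxy
    · exact h₂ _ _ hxy

/-- The poset is the transitive closure of `S`, which is irreflexive because some poset extends
it. -/
theorem exists_relCylinder_eq_setOf_contains {S : Set (V × V)} (hS : (relCylinder S).Nonempty) :
    ∃ Q : LabelledPoset (labels S), relCylinder S = {P | P.Contains Q} := by
  let r : labels S → labels S → Prop := fun x y => ((x : V), (y : V)) ∈ S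
  have hlt : ∀ P ∈ relCylinder S, ∀ x y, Relation.TransGen r x y → P.lt x y := by
    intro P hP x y hxy
    induction hxy with
    | single h => exact hP _ h
    | tail _ h ih => exact P.trans _ _ _ ih (hP _ h)
  obtain ⟨P₀, hP₀⟩ := hS
  refine ⟨⟨Relation.TransGen r, fun x hx => P₀.irrefl _ (hlt P₀ hP₀ x x hx),
    fun _ _ _ => Relation.TransGen.trans⟩, ?_⟩
  ext P
  refine ⟨fun hP => hlt P hP, fun hP p hp => ?_⟩
  exact hP ⟨p.1, .inl ⟨p, hp, rfl⟩⟩ ⟨p.2, .inr ⟨p, hp, rfl⟩⟩ (.single hp)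

end RelCylinder

section Exchangeable

/-- Exchangeability of a measure on the labelled posets on an arbitrary ground set: invariance under
all permutations of the labels. -/
def IsExchangeable (ν : Measure (LabelledPoset V)) : Prop :=
  ∀ σ : Equiv.Perm V, ν.map (relabel σ) = ν

variable {ν : Measure (LabelledPoset V)}

theorem IsExchangeable.measure_relCylinder_image (hν : IsExchangeable ν) {S : Set (V × V)}
    (hS : S.Finite) (σ : Equiv.Perm V) :
    ν (relCylinder (Prod.map σ σ '' S)) = ν (relCylinder S) := by
  conv_rhs => rw [← hν σ, Measure.map_apply (measurable_relabel σ) (measurableSet_relCylinder hS)]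
  rw [← preimage_comap_relCylinder]
  rfl

theorem IsExchangeable.measurePreserving_comap [IsFiniteMeasure ν] (hν : IsExchangeable ν)
    {f : V → V} (hf : Function.Injective f) : MeasurePreserving (comap f) ν ν := by
  refine ⟨measurable_comap f, measure_ext_of_relCylinder fun S hS => ?_⟩
  obtain ⟨σ, hσ⟩ := exists_perm_eqOn (labels_finite hS) hf.injOn
  have himage : Prod.map f f '' S = Prod.map σ σ '' S := Set.image_congr fun p hp =>
    (Prod.ext (hσ (.inl ⟨p, hp, rfl⟩)) (hσ (.inr ⟨p, hp, rfl⟩))).symm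
  rw [Measure.map_apply (measurable_comap f) (measurableSet_relCylinder hS),
    preimage_comap_relCylinder, himage, hν.measure_relCylinder_image hS]

/-- Every permutation of `W` extends along `f` to one of `V` that fixes `A`, and thus preserves the
conditioned measure. -/
theorem IsExchangeable.map_comap_cond (hν : IsExchangeable ν) (f : W ↪ V) {A : Set V}
    (hA : Disjoint A (Set.range f)) {C : Set (LabelledPoset A)} (hC : MeasurableSet C) :
    IsExchangeable ((ν[|(restrict · A) ⁻¹' C]).map (comap f)) := by
  intro σ
  let τ : Equiv.Perm V := σ.viaEmbedding f
  have hτA : ∀ i : A, τ i = i := fun i =>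
    σ.viaEmbedding_apply_of_notMem f i (Set.disjoint_left.mp hA i.2)
  have hτf : ∀ i, τ (f i) = f (σ i) := σ.viaEmbedding_apply f
  have hpre : relabel τ ⁻¹' ((restrict · A) ⁻¹' C) = (restrict · A) ⁻¹' C := by
    have hrestrict : (restrict · A) ∘ relabel τ = (restrict · A) := by
      ext P i j
      simp only [Function.comp_apply, restrict, relabel, hτA]
    rw [← Set.preimage_comp, hrestrict]
  have hcomm : relabel σ ∘ comap f = comap f ∘ relabel τ := by
    ext P i j
    simp only [Function.comp_apply, relabel, comap, hτf]
  have hcond := measurePreserving_cond ⟨measurable_relabel τ, hν τ⟩ (measurable_restrict A hC) hpre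
  rw [Measure.map_map (measurable_relabel σ) (measurable_comap f), hcomm,
    ← Measure.map_map (measurable_comap f) (measurable_relabel τ), hcond.map_eq]

end Exchangeable

section RandomPoset

variable {Ω : Type*}

/-- The σ-field on `Ω` generated by the restriction of the random poset `R` to `A`; `sigmaFrom R n`
is definitionally `sigmaOn R (Set.Ici n)`. -/
abbrev sigmaOn (R : Ω → LabelledPoset V) (A : Set V) : MeasurableSpace Ω :=
  MeasurableSpace.comap (fun ω => (R ω).restrict A) inferInstance

theorem sigmaOn_mono (R : Ω → LabelledPoset V) : Monotone (sigmaOn R) := fun _ B hAB =>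
  measurable_iff_comap_le.mp <| (measurable_comap (Set.inclusion hAB)).comp
    (comap_measurable fun ω => (R ω).restrict B)

theorem sigmaOn_le_comap (R : Ω → LabelledPoset V) (A : Set V) :
    sigmaOn R A ≤ MeasurableSpace.comap R inferInstance :=
  measurable_iff_comap_le.mp ((measurable_restrict A).comp (comap_measurable R))

theorem comap_le_iSup_sigmaOn_Iic [SemilatticeSup V] (R : Ω → LabelledPoset V) :
    MeasurableSpace.comap R inferInstance ≤ ⨆ k, sigmaOn R (Set.Iic k) := by
  let _ := ⨆ k, sigmaOn R (Set.Iic k)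
  refine measurable_iff_comap_le.mp (measurable_of_measurable_lt fun i j => ?_)
  have hlt : Measurable[sigmaOn R (Set.Iic (i ⊔ j))] fun ω => (R ω).lt i j :=
    (measurable_lt_apply (⟨i, le_sup_left⟩ : Set.Iic (i ⊔ j)) ⟨j, le_sup_right⟩).comp
      (comap_measurable _)
  exact hlt.mono (le_iSup (fun k => sigmaOn R (Set.Iic k)) (i ⊔ j)) le_rfl

variable [MeasurableSpace Ω] {μ : Measure Ω} {R : Ω → LabelledPoset V}

/-- The product rule (ii) with finite sets of relations in place of posets. -/
def FactorizesRelations (μ : Measure Ω) (R : Ω → LabelledPoset V) : Prop :=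
  ∀ S₁ S₂ : Set (V × V), S₁.Finite → S₂.Finite → Disjoint (labels S₁) (labels S₂) →
    μ (R ⁻¹' relCylinder S₁ ∩ R ⁻¹' relCylinder S₂) =
      μ (R ⁻¹' relCylinder S₁) * μ (R ⁻¹' relCylinder S₂)

theorem FactorizesRelations.measure_contains_union (h : FactorizesRelations μ R) {A₁ A₂ : Set V}
    (hA₁ : A₁.Finite) (hA₂ : A₂.Finite) (hA : Disjoint A₁ A₂) (Q₁ : LabelledPoset A₁)
    (Q₂ : LabelledPoset A₂) :
    μ {ω | (R ω).Contains (union hA Q₁ Q₂)} =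
      μ {ω | (R ω).Contains Q₁} * μ {ω | (R ω).Contains Q₂} := by
  have hprod := h (relations Q₁) (relations Q₂) (relations_finite hA₁ Q₁) (relations_finite hA₂ Q₂)
    (hA.mono (labels_relations_subset Q₁) (labels_relations_subset Q₂))
  simp only [← setOf_contains_eq_relCylinder] at hprod
  simp only [contains_union_iff, Set.ofPred_and]
  exact hprod

theorem factorizesRelations_of_measure_contains_union [IsProbabilityMeasure μ]
    (h : ∀ (A₁ A₂ : Set V) (_ : A₁.Finite) (_ : A₂.Finite) (_ : A₁.Nonempty) (_ : A₂.Nonempty)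
      (hA : Disjoint A₁ A₂) (Q₁ : LabelledPoset A₁) (Q₂ : LabelledPoset A₂),
      μ {ω | (R ω).Contains (union hA Q₁ Q₂)} =
        μ {ω | (R ω).Contains Q₁} * μ {ω | (R ω).Contains Q₂}) :
    FactorizesRelations μ R := by
  intro S₁ S₂ hS₁ hS₂ hdisj
  rcases S₁.eq_empty_or_nonempty with rfl | hne₁
  · simp [relCylinder_empty]
  rcases S₂.eq_empty_or_nonempty with rfl | hne₂
  · simp [relCylinder_empty]
  rcases (relCylinder S₁).eq_empty_or_nonempty with hC₁ | hC₁
  · simp [hC₁]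
  rcases (relCylinder S₂).eq_empty_or_nonempty with hC₂ | hC₂
  · simp [hC₂]
  obtain ⟨Q₁, hQ₁⟩ := exists_relCylinder_eq_setOf_contains hC₁
  obtain ⟨Q₂, hQ₂⟩ := exists_relCylinder_eq_setOf_contains hC₂
  have hprod := h _ _ (labels_finite hS₁) (labels_finite hS₂) (labels_nonempty hne₁)
    (labels_nonempty hne₂) hdisj Q₁ Q₂
  simp only [contains_union_iff, Set.ofPred_and] at hprod
  rw [hQ₁, hQ₂]
  exact hprod

theorem FactorizesRelations.indepFun_restrict [IsProbabilityMeasure μ] (hR : Measurable R)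
    (h : FactorizesRelations μ R) {B₁ B₂ : Set V} (hB : Disjoint B₁ B₂) :
    IndepFun (fun ω => (R ω).restrict B₁) (fun ω => (R ω).restrict B₂) μ := by
  have hle : ∀ B, sigmaOn R B ≤ ‹MeasurableSpace Ω› := fun B =>
    (sigmaOn_le_comap R B).trans hR.comap_le
  have hgen : ∀ B, sigmaOn R B = MeasurableSpace.generateFrom
      (Set.preimage (fun ω => (R ω).restrict B) '' relCylinders B) := fun B => by
    rw [← MeasurableSpace.comap_generateFrom, generateFrom_relCylinders]
  have hpre : ∀ (B : Set V) (S : Set (B × B)), (fun ω => (R ω).restrict B) ⁻¹' relCylinder S =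
      R ⁻¹' relCylinder (Prod.map (↑) (↑) '' S) := fun B S => by
    rw [← preimage_comap_relCylinder]
    rfl
  have hlabels : ∀ (B : Set V) (S : Set (B × B)), labels (Prod.map (↑) (↑) '' S) ⊆ B := fun B S =>
    labels_image ((↑) : B → V) S ▸ Subtype.coe_image_subset B _
  refine IndepSets.indep (hle B₁) (hle B₂) (isPiSystem_relCylinders.comap _)
    (isPiSystem_relCylinders.comap _) (hgen B₁) (hgen B₂) ((IndepSets_iff _ _ _).mpr ?_)
  rintro _ _ ⟨_, ⟨S₁, hS₁, rfl⟩, rfl⟩ ⟨_, ⟨S₂, hS₂, rfl⟩, rfl⟩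
  rw [hpre, hpre]
  exact h _ _ (Set.Finite.image _ hS₁) (Set.Finite.image _ hS₂)
    (hB.mono (hlabels B₁ S₁) (hlabels B₂ S₂))

theorem measure_inter_relCylinder_of_labels_subset {B₁ B₂ : Set V}
    (h : IndepFun (fun ω => (R ω).restrict B₁) (fun ω => (R ω).restrict B₂) μ)
    {S₁ S₂ : Set (V × V)} (hS₁ : S₁.Finite) (hS₂ : S₂.Finite) (hB₁ : labels S₁ ⊆ B₁)
    (hB₂ : labels S₂ ⊆ B₂) :
    μ (R ⁻¹' relCylinder S₁ ∩ R ⁻¹' relCylinder S₂) =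
      μ (R ⁻¹' relCylinder S₁) * μ (R ⁻¹' relCylinder S₂) := by
  have hfin : ∀ (B : Set V) {S : Set (V × V)}, S.Finite →
      (Prod.map ((↑) : B → V) ((↑) : B → V) ⁻¹' S).Finite := fun B _ hS =>
    hS.preimage (Subtype.val_injective.prodMap Subtype.val_injective).injOn
  rw [relCylinder_eq_preimage_restrict hB₁, relCylinder_eq_preimage_restrict hB₂]
  exact h.measure_inter_preimage_eq_mul _ _ (measurableSet_relCylinder (hfin B₁ hS₁))
    (measurableSet_relCylinder (hfin B₂ hS₂))

theorem IsExchangeable.measure_inter_relCylinder_of_indepFun_restrict (hR : Measurable R)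
    (hexch : IsExchangeable (μ.map R)) {B₁ B₂ : Set V} (hB₂ : B₂.Infinite)
    (h : IndepFun (fun ω => (R ω).restrict B₁) (fun ω => (R ω).restrict B₂) μ)
    {S₁ S₂ : Set (V × V)} (hS₁ : S₁.Finite) (hS₂ : S₂.Finite) (hB₁ : labels S₁ ⊆ B₁)
    (hdisj : Disjoint (labels S₁) (labels S₂)) :
    μ (R ⁻¹' relCylinder S₁ ∩ R ⁻¹' relCylinder S₂) =
      μ (R ⁻¹' relCylinder S₁) * μ (R ⁻¹' relCylinder S₂) := by
  obtain ⟨σ, hσ₁, hσ₂⟩ :=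
    exists_perm_eqOn_id_mapsTo (labels_finite hS₁) (labels_finite hS₂) hdisj hB₂
  have hmove : ∀ S : Set (V × V), S.Finite →
      μ (R ⁻¹' relCylinder (Prod.map σ σ '' S)) = μ (R ⁻¹' relCylinder S) := fun S hS => by
    rw [← Measure.map_apply hR (measurableSet_relCylinder (hS.image _)),
      hexch.measure_relCylinder_image hS, Measure.map_apply hR (measurableSet_relCylinder hS)]
  have hlabels₁ : labels (Prod.map σ σ '' S₁) ⊆ B₁ := by
    rwa [labels_image, hσ₁.image_eq, Set.image_id]
  have hlabels₂ : labels (Prod.map σ σ '' S₂) ⊆ B₂ := by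
    rw [labels_image]
    exact hσ₂.image_subset
  have hinter : μ (R ⁻¹' relCylinder S₁ ∩ R ⁻¹' relCylinder S₂) =
      μ (R ⁻¹' relCylinder (Prod.map σ σ '' S₁) ∩ R ⁻¹' relCylinder (Prod.map σ σ '' S₂)) := by
    simp only [← Set.preimage_inter, ← relCylinder_union, ← Set.image_union]
    exact (hmove _ (hS₁.union hS₂)).symm
  rw [hinter, measure_inter_relCylinder_of_labels_subset h (hS₁.image _)
    (hS₂.image _) hlabels₁ hlabels₂, hmove S₁ hS₁, hmove S₂ hS₂]

end RandomPoset

theorem indepFun_restrict_of_mem_extremePoints {ν : Measure (LabelledPoset ℕ+)}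
    (hν : ν ∈ exchangeableLaws.extremePoints ℝ≥0) {A B : Set ℕ+} (hAB : Disjoint A B)
    (hB : B.Infinite) : IndepFun (restrict · A) (restrict · B) ν := by
  have : IsProbabilityMeasure ν := hν.1.1
  have : Infinite B := hB.to_subtype
  obtain ⟨e⟩ : Nonempty (ℕ+ ≃ B) := nonempty_equiv_of_countable
  let f : ℕ+ ↪ ℕ+ := e.toEmbedding.trans (.subtype _)
  have hA : Disjoint A (Set.range f) := hAB.mono_right (by rintro _ ⟨i, rfl⟩; exact (e i).2)
  have hmap : ν.map (comap f) = ν :=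
    (IsExchangeable.measurePreserving_comap hν.1.2 f.injective).map_eq
  have hind : IndepFun (restrict · A) (comap f) ν := by
    refine indepFun_of_map_mem_extremePoints (K := exchangeableLaws) (measurable_restrict A)
      (measurable_comap f) (hmap.symm ▸ hν) fun C hC h0 => ?_
    have := cond_isProbabilityMeasure h0
    exact ⟨Measure.isProbabilityMeasure_map (measurable_comap f).aemeasurable,
      IsExchangeable.map_comap_cond hν.1.2 f hA hC⟩
  have hrestrict : comap e.symm ∘ comap f = (restrict · B) := by
    ext P i j
    simp [comap, restrict, f]
  exact hrestrict ▸ hind.comp measurable_id (measurable_comap e.symm)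

section Tail

theorem preimage_comap_add_of_shift_invariant {s : Set (LabelledPoset ℕ+)}
    (hs : comap (· + 1) ⁻¹' s = s) (n : ℕ+) : comap (· + n) ⁻¹' s = s := by
  induction n with
  | one => exact hs
  | succ n ih =>
    have hcomp : comap (· + (n + 1)) = comap (· + 1) ∘ comap (V := ℕ+) (· + n) := by
      ext P i j
      simp only [Function.comp_apply, comap, add_assoc, add_comm 1 n]
    rw [hcomp, Set.preimage_comp, hs, ih]

theorem measurableSet_tailSigma_of_shift_invariant {Ω : Type*} (R : Ω → LabelledPoset ℕ+)
    {s : Set (LabelledPoset ℕ+)} (hs : MeasurableSet s) (hinv : comap (· + 1) ⁻¹' s = s) :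
    MeasurableSet[tailSigma R] (R ⁻¹' s) := by
  refine MeasurableSpace.measurableSet_iInf.mpr fun n => ?_
  refine ⟨comap (fun i : ℕ+ => (⟨i + n, (PNat.lt_add_left n i).le⟩ : Set.Ici n)) ⁻¹' s,
    measurable_comap _ hs, ?_⟩
  conv_rhs => rw [← preimage_comap_add_of_shift_invariant hinv n]
  rfl

variable {Ω : Type*} [MeasurableSpace Ω] {μ : Measure Ω} [IsProbabilityMeasure μ]
  {R : Ω → LabelledPoset ℕ+}

theorem measure_tail_eq_zero_or_one_of_indepFun (hR : Measurable R)
    (h : ∀ k : ℕ+, IndepFun (fun ω => (R ω).restrict (Set.Iic k))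
      (fun ω => (R ω).restrict (Set.Ici (k + 1))) μ)
    {E : Set Ω} (hE : MeasurableSet[tailSigma R] E) : μ E = 0 ∨ μ E = 1 := by
  have htail : tailSigma R ≤ MeasurableSpace.comap R inferInstance :=
    (iInf_le _ 1).trans (sigmaOn_le_comap R (Set.Ici 1))
  refine measure_eq_zero_or_one_of_le_iSup_of_indep (m := fun k => sigmaOn R (Set.Iic k))
    (fun _ _ hkl => sigmaOn_mono R (Set.Iic_subset_Iic.mpr hkl))
    (fun k => (sigmaOn_le_comap R _).trans hR.comap_le)
    (htail.trans (comap_le_iSup_sigmaOn_Iic R)) (fun k => ?_) hE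
  exact indep_of_indep_of_le_right (h k) (iInf_le _ (k + 1))

theorem ergodic_shift_of_tail_trivial (hR : Measurable R)
    (hshift : MeasurePreserving (comap (· + 1)) (μ.map R) (μ.map R))
    (h : ∀ E : Set Ω, MeasurableSet[tailSigma R] E → μ E = 0 ∨ μ E = 1) :
    Ergodic (comap (· + 1)) (μ.map R) := by
  have := Measure.isProbabilityMeasure_map (μ := μ) hR.aemeasurable
  refine ⟨hshift, ⟨fun s hs hinv => ?_⟩⟩
  rw [Filter.eventuallyConst_set', ae_eq_empty, ae_eq_univ, prob_compl_eq_zero_iff hs,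
    Measure.map_apply hR hs]
  exact h _ (measurableSet_tailSigma_of_shift_invariant R hs hinv)

theorem mem_extremePoints_of_tail_trivial (hR : Measurable R)
    (hexch : μ.map R ∈ exchangeableLaws)
    (h : ∀ E : Set Ω, MeasurableSet[tailSigma R] E → μ E = 0 ∨ μ E = 1) :
    μ.map R ∈ exchangeableLaws.extremePoints ℝ≥0 := by
  have hshift : ∀ ν ∈ exchangeableLaws, MeasurePreserving (comap (· + 1)) ν ν := by
    rintro ν ⟨_, hν⟩
    exact IsExchangeable.measurePreserving_comap hν (add_left_injective 1)
  have := hexch.1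
  exact mem_extremePoints_of_ergodic (ergodic_shift_of_tail_trivial hR (hshift _ hexch) h)
    (fun ν hν => ⟨hshift ν hν, hν.1⟩) hexch

end Tail

end LabelledPoset

open LabelledPoset

theorem theorem1p6 {Ω : Type*} [MeasurableSpace Ω] (μ : Measure Ω) [IsProbabilityMeasure μ]
    (R : Ω → LabelledPoset ℕ+) (hR : Measurable R) (hexch : μ.map R ∈ exchangeableLaws) :
    List.TFAE [
      μ.map R ∈ Set.extremePoints ℝ≥0 exchangeableLaws,
      ∀ (A₁ A₂ : Set ℕ+) (_ : A₁.Finite) (_ : A₂.Finite) (_ : A₁.Nonempty) (_ : A₂.Nonempty)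
        (hdisj : Disjoint A₁ A₂) (Q₁ : LabelledPoset A₁) (Q₂ : LabelledPoset A₂),
        μ {ω | (R ω).Contains (LabelledPoset.union hdisj Q₁ Q₂)} =
          μ {ω | (R ω).Contains Q₁} * μ {ω | (R ω).Contains Q₂},
      ∀ k : ℕ+, IndepFun (fun ω => (R ω).restrict (Set.Iic k))
        (fun ω => (R ω).restrict (Set.Ici (k + 1))) μ,
      ∀ E : Set Ω, MeasurableSet[tailSigma R] E → μ E = 0 ∨ μ E = 1] := by
  have hdisj : ∀ k : ℕ+, Disjoint (Set.Iic k) (Set.Ici (k + 1)) := fun k =>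
    Set.Iic_disjoint_Ici.mpr (PNat.lt_add_right k 1).not_ge
  tfae_have 1 → 3 := fun h k =>
    indepFun_comp_of_map hR (measurable_restrict _) (measurable_restrict _)
      (indepFun_restrict_of_mem_extremePoints h (hdisj k) (Set.Ici_infinite _))
  tfae_have 3 → 4 := fun h _ hE => measure_tail_eq_zero_or_one_of_indepFun hR h hE
  tfae_have 4 → 1 := mem_extremePoints_of_tail_trivial hR hexch
  tfae_have 3 → 2 := by
    intro h A₁ A₂ hA₁ hA₂ _ _ hA Q₁ Q₂
    refine FactorizesRelations.measure_contains_union (fun S₁ S₂ hS₁ hS₂ hS => ?_) hA₁ hA₂ hA Q₁ Q₂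
    obtain ⟨k, hk⟩ := (labels_finite hS₁).bddAbove
    exact IsExchangeable.measure_inter_relCylinder_of_indepFun_restrict hR hexch.2
      (Set.Ici_infinite (k + 1)) (h k) hS₁ hS₂ hk hS
  tfae_have 2 → 3 := fun h k =>
    (factorizesRelations_of_measure_contains_union h).indepFun_restrict hR (hdisj k)
  tfae_finish
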